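/- Let $k$ be either a $p$-adic field, i.e. a finite extension of $\mathbb{Q}_p$ for some prime $p$ (with its $p$-adic topology), or the field $\mathbb{R}$ of real numbers (with its usual topology). For $n\geq 1$ let $\mathrm{Sym}_n(k)$ be the space of symmetric $n\times n$ matrices over $k$, with the topology induced from that of $k$; a matrix $A\in \mathrm{Sym}_n(k)$ is identified with the quadratic form $x\mapsto x^{t}Ax$ in $n$ variables. For an integer $m\geq 0$, a quadratic form $T$ over $k$ is said to split $m$ hyperbolic planes if it is isometric to an orthogonal sum $$\underbrace{\langle -1,1\rangle\perp\cdots\perp\langle -1,1\rangle}_{m}\perp T'$$ for some (possibly degenerate, possibly zero-dimensional) quadratic form $T'$ over $k$. A quadratic form in $2n$ variables is said to be purely hyperbolic if it splits $n$ hyperbolic planes. Then: 1. For every integer $n\geq 1$, the set of purely hyperbolic quadratic forms in $2n$ variables is open in $\mathrm{Sym}_{2n}(k)$. 2. For all integers $n\geq 1$ and $m\geq 0$, the set of quadratic forms in $n$ variables that split $m$ hyperbolic planes is open in $\mathrm{Sym}_n(k)$. -/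

import Mathlib

/-- A `p`-adic field: a finite extension of `ℚ_[p]` for some prime `p` (`p = 2` is allowed), with its
`p`-adic topology, i.e. the topology of a finite-dimensional `ℚ_[p]`-vector space. -/
def IsPadicField (k : Type*) [Field k] [TopologicalSpace k] : Prop :=
  ∃ (p : ℕ) (_ : Fact p.Prime) (_ : Algebra ℚ_[p] k),
    FiniteDimensional ℚ_[p] k ∧ IsModuleTopology ℚ_[p] k

/-- The field of real numbers, up to isomorphism of topological fields. -/
def IsRealField (k : Type*) [Field k] [TopologicalSpace k] : Prop :=
  ∃ e : k ≃+* ℝ, IsHomeomorph e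

/-- `Sym_n(k)`: symmetric `n × n` matrices, with the subspace topology whenever `k` has a
topology. -/
abbrev SymMatrix (n : ℕ) (k : Type*) : Type _ :=
  {A : Matrix (Fin n) (Fin n) k // A.IsSymm}

/-- The quadratic form `x ↦ xᵀ A x` in `n` variables given by a symmetric matrix `A`. -/
def SymMatrix.form {n : ℕ} {k : Type*} [Field k] (A : SymMatrix n k) :
    QuadraticForm k (Fin n → k) :=
  A.1.toQuadraticForm'

/-- The hyperbolic plane `⟨-1, 1⟩`, that is `(x, y) ↦ -x² + y²`. -/
def hyperbolicPlane (k : Type*) [Field k] : QuadraticForm k (Fin 2 → k) :=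
  QuadraticMap.weightedSumSquares k (![-1, 1] : Fin 2 → k)

/-- `T` splits `m` hyperbolic planes: `T ≅ ⟨-1, 1⟩ ⊥ ⋯ ⊥ ⟨-1, 1⟩ ⊥ T'` with `m` copies of
`⟨-1, 1⟩`, for some quadratic form `T'` in finitely many variables (possibly none). -/
def SplitsHyperbolicPlanes {k V : Type*} [Field k] [AddCommGroup V] [Module k V]
    (T : QuadraticForm k V) (m : ℕ) : Prop :=
  ∃ (r : ℕ) (T' : QuadraticForm k (Fin r → k)),
    QuadraticMap.Equivalent T
      ((QuadraticMap.pi fun _ : Fin m => hyperbolicPlane k).prod T')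

/-- A quadratic form in `2n` variables is purely hyperbolic if it splits `n` hyperbolic planes. -/
def IsPurelyHyperbolic {k : Type*} [Field k] {n : ℕ}
    (T : QuadraticForm k (Fin (2 * n) → k)) : Prop :=
  SplitsHyperbolicPlanes T n

open Filter Topology

/-! When `2` is invertible, a form splits `m` hyperbolic planes exactly when some `2m` vectors have
Gram matrix with diagonal `-1, 1, …, -1, 1` and zeros elsewhere
(`SplitsHyperbolicPlanes.exists_gram`, `splitsHyperbolicPlanes_of_gram`). Fix such vectors for `A`.
For `A'` near `A` their Gram matrix is close to the same diagonal matrix. Gram–Schmidt makes it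
exactly diagonal with entries still close to `±1`, and rescaling makes the entries exact because
elements near `1` are squares. The pure case is the general one with `2n` variables and `m = n`. -/

/-- In a complete nontrivially normed field in which `2` is invertible, the squares form a
neighbourhood of `1`. -/
theorem isSquare_mem_nhds_one (K : Type*) [NontriviallyNormedField K] [CompleteSpace K]
    (h2 : (2 : K) ≠ 0) : {x : K | IsSquare x} ∈ 𝓝 (1 : K) := by
  have hd : HasStrictDerivAt (fun x : K => x ^ 2) 2 1 := by
    simpa using hasStrictDerivAt_pow 2 (1 : K)
  -- The derivative `2` is invertible, so by the inverse function theorem squaring maps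
  -- neighbourhoods of `1` onto neighbourhoods of `1`.
  have hmap := hd.map_nhds_eq h2
  rw [one_pow] at hmap
  rw [← hmap, mem_map]
  exact univ_mem' fun x => ⟨x, pow_two x⟩

/-- A topological field of characteristic different from `2` in which every element close to `1`
is a square. -/
structure IsLocallySquareField (k : Type*) [Field k] [TopologicalSpace k] : Prop where
  isTopologicalRing : IsTopologicalRing k
  continuousInv₀ : ContinuousInv₀ k
  t1Space : T1Space k
  two_ne_zero : (2 : k) ≠ 0
  isSquare_mem_nhds_one : {x : k | IsSquare x} ∈ 𝓝 (1 : k)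

theorem IsPadicField.isLocallySquareField {k : Type*} [Field k] [τ : TopologicalSpace k]
    (hk : IsPadicField k) : IsLocallySquareField k := by
  obtain ⟨p, _, _, _, hτ⟩ := hk
  have h2 : (2 : k) ≠ 0 := by
    have := charZero_of_injective_algebraMap (algebraMap ℚ_[p] k).injective
    exact two_ne_zero
  -- The module topology is determined by the algebra structure, so it can be identified with the
  -- topology of the spectral norm, which is complete.
  rw [hτ.eq_moduleTopology']
  clear hτ τ
  let : NontriviallyNormedField k := spectralNorm.nontriviallyNormedField ℚ_[p] k
  let : NormedSpace ℚ_[p] k := spectralNorm.normedSpace ℚ_[p] k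
  have : CompleteSpace k := FiniteDimensional.complete ℚ_[p] k
  have : IsModuleTopology ℚ_[p] k := isModuleTopologyOfFiniteDimensional
  rw [← eq_moduleTopology ℚ_[p] k]
  exact ⟨inferInstance, inferInstance, inferInstance, h2, isSquare_mem_nhds_one k h2⟩

theorem IsRealField.isLocallySquareField {k : Type*} [Field k] [TopologicalSpace k]
    (hk : IsRealField k) : IsLocallySquareField k := by
  obtain ⟨e, he⟩ := hk
  have hi : IsInducing e := he.isInducing
  have hring : IsTopologicalRing k :=
    { continuous_add := hi.continuous_iff.2 <| by
        simpa [Function.comp_def, Pi.add_def] using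
          (he.continuous.comp continuous_fst).add (he.continuous.comp continuous_snd)
      continuous_mul := hi.continuous_iff.2 <| by
        simpa [Function.comp_def, Pi.mul_def] using
          (he.continuous.comp continuous_fst).mul (he.continuous.comp continuous_snd)
      continuous_neg := hi.continuous_iff.2 <| by
        simp only [Function.comp_def, map_neg]
        exact he.continuous.neg }
  refine ⟨hring, ⟨fun x hx => ?_⟩, he.isEmbedding.t1Space,
    fun h => two_ne_zero (α := ℝ) (by rw [← map_ofNat e 2, h, map_zero]), ?_⟩
  · rw [hi.continuousAt_iff]
    have : e ∘ (fun x => x⁻¹) = fun x => (e x)⁻¹ := by ext; simp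
    rw [this]
    exact he.continuous.continuousAt.inv₀ (by simpa using hx)
  · rw [hi.nhds_eq_comap, map_one]
    refine ⟨_, isSquare_mem_nhds_one ℝ two_ne_zero, fun x hx => ?_⟩
    obtain ⟨r, hr⟩ := hx
    exact ⟨e.symm r, e.injective (by simpa using hr)⟩

/-- If the Gram matrices of a family of vectors, with respect to a varying symmetric bilinear form,
converge to a nondegenerate diagonal matrix, then eventually the span of these vectors contains
vectors having exactly this diagonal matrix as Gram matrix. -/
theorem IsLocallySquareField.eventually_exists_gram_eq_diagonal {k : Type*} [Field k]
    [TopologicalSpace k] (hk : IsLocallySquareField k) {V X : Type*} [AddCommGroup V] [Module k V]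
    {l : Filter X} (B : X → LinearMap.BilinForm k V) (hB : ∀ x, (B x).IsSymm) (s : ℕ)
    (v : X → Fin s → V) (d : Fin s → k) (hd : ∀ i, d i ≠ 0)
    (hv : ∀ i j, Tendsto (fun x => B x (v x i) (v x j)) l (𝓝 (Matrix.diagonal d i j))) :
    ∀ᶠ x in l, ∃ w : Fin s → V, (∀ i, w i ∈ Submodule.span k (Set.range (v x))) ∧
      ∀ i j, B x (w i) (w j) = Matrix.diagonal d i j := by
  obtain ⟨_, _, _, -, hsq⟩ := hk
  induction s with
  | zero => exact Eventually.of_forall fun x => ⟨v x, fun i => i.elim0, fun i => i.elim0⟩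
  | succ s ih =>
    have h00 : Tendsto (fun x => B x (v x 0) (v x 0)) l (𝓝 (d 0)) := by simpa using hv 0 0
    -- Gram–Schmidt step: the remaining vectors are made orthogonal to `v x 0`. They now depend on
    -- `x` even if `v` did not, hence the varying family in the statement.
    set u : X → Fin s → V := fun x j =>
      v x j.succ - (B x (v x 0) (v x j.succ) / B x (v x 0) (v x 0)) • v x 0 with hu
    have hne : ∀ᶠ x in l, B x (v x 0) (v x 0) ≠ 0 := h00.eventually_ne (hd 0)
    have hort : ∀ x, B x (v x 0) (v x 0) ≠ 0 → ∀ j, B x (v x 0) (u x j) = 0 := by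
      intro x hx j
      simp only [hu, map_sub, map_smul, smul_eq_mul]
      field_simp
      ring
    have hgram : ∀ x, B x (v x 0) (v x 0) ≠ 0 → ∀ i j, B x (u x i) (u x j) =
        B x (v x i.succ) (v x j.succ) -
          B x (v x 0) (v x i.succ) * B x (v x 0) (v x j.succ) / B x (v x 0) (v x 0) := by
      intro x hx i j
      conv_lhs => rw [hu]
      have := hort x hx j
      simp only [hu] at this
      simp only [map_sub (B x), map_smul (B x), LinearMap.sub_apply, LinearMap.smul_apply, this]
      simp only [map_sub, map_smul, smul_eq_mul, (hB x).eq (v x i.succ) (v x 0)]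
      ring
    have hlim : ∀ i j, Tendsto (fun x => B x (u x i) (u x j)) l
        (𝓝 (Matrix.diagonal (fun i => d i.succ) i j)) := by
      intro i j
      have h : Tendsto (fun x => B x (v x i.succ) (v x j.succ) -
          B x (v x 0) (v x i.succ) * B x (v x 0) (v x j.succ) / B x (v x 0) (v x 0)) l
          (𝓝 (Matrix.diagonal d i.succ j.succ -
            Matrix.diagonal d 0 i.succ * Matrix.diagonal d 0 j.succ / d 0)) :=
        (hv _ _).sub (((hv _ _).mul (hv _ _)).div h00 (hd 0))
      have he : Matrix.diagonal d i.succ j.succ -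
            Matrix.diagonal d 0 i.succ * Matrix.diagonal d 0 j.succ / d 0 =
          Matrix.diagonal (fun i => d i.succ) i j := by
        simp [Matrix.diagonal_apply, (Fin.succ_ne_zero _).symm]
      rw [he] at h
      exact h.congr' (hne.mono fun x hx => (hgram x hx i j).symm)
    -- A square root of this ratio is the factor that rescales `v x 0` to have value exactly `d 0`.
    have hroot : ∀ᶠ x in l, IsSquare (d 0 / B x (v x 0) (v x 0)) := by
      have : Tendsto (fun x => d 0 / B x (v x 0) (v x 0)) l (𝓝 1) := by
        simpa [div_self (hd 0), Pi.div_def] using (tendsto_const_nhds (x := d 0)).div h00 (hd 0)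
      exact this hsq
    filter_upwards [hne, hroot, ih u (fun i => d i.succ) (fun i => hd _) hlim]
      with x hx ⟨t, ht⟩ ⟨w, hw, hwB⟩
    have hv0 : v x 0 ∈ Submodule.span k (Set.range (v x)) := Submodule.subset_span ⟨0, rfl⟩
    have hspan : Submodule.span k (Set.range (u x)) ≤ Submodule.span k (Set.range (v x)) := by
      rw [Submodule.span_le]
      rintro _ ⟨j, rfl⟩
      exact sub_mem (Submodule.subset_span ⟨_, rfl⟩) (Submodule.smul_mem _ _ hv0)
    -- The span clause carried through the induction is what gives this orthogonality.
    have hker : ∀ j, B x (v x 0) (w j) = 0 := by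
      have hle : Submodule.span k (Set.range (u x)) ≤ LinearMap.ker (B x (v x 0)) := by
        rw [Submodule.span_le]
        rintro _ ⟨j, rfl⟩
        exact hort x hx j
      exact fun j => hle (hw j)
    have hker' : ∀ j, B x (w j) (v x 0) = 0 := fun j => by
      rw [← (hB x).eq]; simpa using hker j
    have ht' : t * (t * B x (v x 0) (v x 0)) = d 0 := by
      rw [← mul_assoc, ← ht, div_mul_cancel₀ _ hx]
    refine ⟨Fin.cons (t • v x 0) w, fun i => ?_, fun i j => ?_⟩
    · refine Fin.cases ?_ (fun i => ?_) i
      · exact Submodule.smul_mem _ _ hv0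
      · exact hspan (hw i)
    · refine Fin.cases ?_ (fun i => ?_) i <;> refine Fin.cases ?_ (fun j => ?_) j
      · simpa using ht'
      · simp [hker, (Fin.succ_ne_zero _).symm]
      · simp [hker']
      · simp [hwB, Matrix.diagonal_apply]

/-- The diagonal coefficients of an orthogonal sum of hyperbolic planes. -/
def hyperbolicWeight (k : Type*) [Field k] {m : ℕ} (i : Fin m × Fin 2) : k :=
  (![-1, 1] : Fin 2 → k) i.2

theorem hyperbolicWeight_mul_self {k : Type*} [Field k] {m : ℕ} (i : Fin m × Fin 2) :
    hyperbolicWeight k i * hyperbolicWeight k i = 1 := by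
  obtain ⟨i, j⟩ := i
  fin_cases j <;> simp [hyperbolicWeight]

theorem pi_hyperbolicPlane_apply {k : Type*} [Field k] {m : ℕ} (c : Fin m → Fin 2 → k) :
    QuadraticMap.pi (fun _ : Fin m => hyperbolicPlane k) c =
      ∑ i : Fin m × Fin 2, hyperbolicWeight k i * (c i.1 i.2 * c i.1 i.2) := by
  simp [QuadraticMap.pi_apply, hyperbolicPlane, QuadraticMap.weightedSumSquares_apply,
    Fintype.sum_prod_type, hyperbolicWeight]

theorem polar_pi_hyperbolicPlane {k : Type*} [Field k] {m : ℕ} (c c' : Fin m → Fin 2 → k) :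
    QuadraticMap.polar (QuadraticMap.pi fun _ : Fin m => hyperbolicPlane k) c c' =
      2 * ∑ i : Fin m × Fin 2, hyperbolicWeight k i * (c i.1 i.2 * c' i.1 i.2) := by
  simp only [QuadraticMap.polar, pi_hyperbolicPlane_apply, Finset.mul_sum,
    ← Finset.sum_sub_distrib, Pi.add_apply]
  exact Finset.sum_congr rfl fun i _ => by ring

/-- A quadratic form splits `m` hyperbolic planes as soon as it has `2m` vectors with the Gram
matrix of such a sum. -/
theorem splitsHyperbolicPlanes_of_gram {k V : Type*} [Field k] [AddCommGroup V] [Module k V]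
    [FiniteDimensional k V] {B : LinearMap.BilinForm k V} (hB : B.IsSymm) {m : ℕ}
    (w : Fin m × Fin 2 → V)
    (hw : ∀ i j, B (w i) (w j) = Matrix.diagonal (hyperbolicWeight k) i j) :
    SplitsHyperbolicPlanes (LinearMap.BilinMap.toQuadraticMap B) m := by
  classical
  -- The orthogonal complement of the `w i`. Their span is nondegenerate, so `V` is the direct sum
  -- of the two, and the form on `N` serves as `T'`.
  let N : Submodule k V := ⨅ i, LinearMap.ker (B (w i))
  have hN : ∀ (n : N) i, B (w i) n = 0 := fun n i => by
    have := n.2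
    simp only [N, Submodule.mem_iInf] at this
    exact this i
  let f : (Fin m → Fin 2 → k) →ₗ[k] V :=
    ∑ i : Fin m × Fin 2,
      ((LinearMap.proj i.2 : (Fin 2 → k) →ₗ[k] k) ∘ₗ LinearMap.proj i.1).smulRight (w i)
  have hf : ∀ c, f c = ∑ i : Fin m × Fin 2, c i.1 i.2 • w i := fun c => by simp [f]
  have hBf : ∀ c i, B (w i) (f c) = hyperbolicWeight k i * c i.1 i.2 := fun c i => by
    simp [hf, hw, Matrix.diagonal_apply, mul_comm]
  have hcomp : ∀ c x, B (f c) x = ∑ i : Fin m × Fin 2, c i.1 i.2 * B (w i) x := fun c x => by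
    simp [hf]
  let g := f.coprod N.subtype
  have hg : ∀ c n, g (c, n) = f c + n := fun c n => by simp [g]
  have hinj : Function.Injective g := by
    rw [← LinearMap.ker_eq_bot, LinearMap.ker_eq_bot']
    rintro ⟨c, n⟩ h
    rw [hg] at h
    have hc : c = 0 := by
      ext i j
      have h1 := congrArg (B (w (i, j))) h
      rw [map_add, hBf, hN, add_zero, map_zero] at h1
      have h2 := hyperbolicWeight_mul_self (k := k) (i, j)
      exact (mul_eq_zero.1 h1).resolve_left (left_ne_zero_of_mul_eq_one h2)
    subst hc
    simpa using h
  have hsurj : Function.Surjective g := by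
    intro x
    -- Coefficients of the orthogonal projection of `x`; each weight `±1` is its own inverse.
    let c : Fin m → Fin 2 → k := fun i j => hyperbolicWeight k (i, j) * B (w (i, j)) x
    have hx : x - f c ∈ N := by
      simp only [N, Submodule.mem_iInf, LinearMap.mem_ker, map_sub, hBf, c]
      intro i
      rw [← mul_assoc, hyperbolicWeight_mul_self, one_mul, sub_self]
    exact ⟨(c, ⟨_, hx⟩), by simp [hg]⟩
  let b := (Module.finBasis k N).equivFun
  let E : ((Fin m → Fin 2 → k) × (Fin (Module.finrank k N) → k)) ≃ₗ[k] V :=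
    (LinearEquiv.prodCongr (LinearEquiv.refl k _) b.symm).trans
      (LinearEquiv.ofBijective g ⟨hinj, hsurj⟩)
  refine ⟨Module.finrank k N,
    (LinearMap.BilinMap.toQuadraticMap B).comp (N.subtype ∘ₗ b.symm.toLinearMap), ⟨?_⟩⟩
  refine QuadraticMap.IsometryEquiv.symm ⟨E, fun ⟨c, y⟩ => ?_⟩
  have hE : E (c, y) = f c + b.symm y := hg c (b.symm y)
  change B (E (c, y)) (E (c, y)) = _
  have h1 : B (f c) (b.symm y : N) = 0 := by simp [hcomp, hN]
  have h2 : B (b.symm y : N) (f c) = 0 := by rw [← hB.eq]; simpa using h1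
  rw [hE, map_add, map_add, LinearMap.add_apply, LinearMap.add_apply, h1, h2, hcomp,
    QuadraticMap.prod_apply, pi_hyperbolicPlane_apply, add_zero, zero_add]
  congr 1
  exact Finset.sum_congr rfl fun i _ => by rw [hBf]; ring

/-- The vectors are the images of the standard basis. An isometry preserves only the quadratic form,
so the Gram matrix is recovered by polarization, up to the factor `2` cancelled at the end. -/
theorem SplitsHyperbolicPlanes.exists_gram {k V : Type*} [Field k] [AddCommGroup V] [Module k V]
    (h2 : (2 : k) ≠ 0) {B : LinearMap.BilinForm k V} (hB : B.IsSymm) {m : ℕ}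
    (h : SplitsHyperbolicPlanes (LinearMap.BilinMap.toQuadraticMap B) m) :
    ∃ w : Fin m × Fin 2 → V,
      ∀ i j, B (w i) (w j) = Matrix.diagonal (hyperbolicWeight k) i j := by
  obtain ⟨r, T', ⟨e⟩⟩ := h
  let b : Fin m × Fin 2 → Fin m → Fin 2 → k := fun i => Pi.single i.1 (Pi.single i.2 1)
  have hb : ∀ i j : Fin m × Fin 2, b i j.1 j.2 = if j = i then 1 else 0 := by
    rintro ⟨i, i'⟩ ⟨j, j'⟩
    by_cases h : j = i
    · subst h; simp [b, Pi.single_apply]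
    · simp [b, h]
  refine ⟨fun i => e.symm (b i, 0), fun i j => ?_⟩
  have hQ : ∀ c, B (e.symm (c, 0)) (e.symm (c, 0)) =
      QuadraticMap.pi (fun _ : Fin m => hyperbolicPlane k) c := fun c => by
    have := e.symm.map_app (c, 0)
    rw [QuadraticMap.prod_apply, map_zero, add_zero] at this
    exact this
  have hpol := polar_pi_hyperbolicPlane (b i) (b j)
  rw [QuadraticMap.polar, ← hQ, ← hQ, ← hQ] at hpol
  have hadd : e.symm (b i + b j, 0) = e.symm (b i, 0) + e.symm (b j, 0) := by
    rw [← map_add]; simp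
  have hs : B (e.symm (b j, 0)) (e.symm (b i, 0)) = B (e.symm (b i, 0)) (e.symm (b j, 0)) := by
    rw [← hB.eq]
  rw [hadd] at hpol
  simp only [map_add, LinearMap.add_apply, hs] at hpol
  have hsum : ∑ l : Fin m × Fin 2, hyperbolicWeight k l * (b i l.1 l.2 * b j l.1 l.2) =
      Matrix.diagonal (hyperbolicWeight k) i j := by
    simp only [hb, Matrix.diagonal_apply]
    by_cases h : i = j
    · simp [h]
    · simp [h, Ne.symm h]
  rw [hsum] at hpol
  refine mul_left_cancel₀ h2 ?_
  rw [← hpol]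
  ring

theorem IsLocallySquareField.isOpen_splitsHyperbolicPlanes {k : Type*} [Field k]
    [TopologicalSpace k] (hk : IsLocallySquareField k) (n m : ℕ) :
    IsOpen {A : SymMatrix n k | SplitsHyperbolicPlanes A.form m} := by
  have := hk.isTopologicalRing
  let B : SymMatrix n k → LinearMap.BilinForm k (Fin n → k) := fun A => Matrix.toLinearMap₂' k A.1
  have hBapp : ∀ A v w, B A v w = v ⬝ᵥ A.1.mulVec w := fun A v w =>
    Matrix.toLinearMap₂'_apply' A.1 v w
  have hB : ∀ A, (B A).IsSymm := fun A => ⟨fun v w => by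
    rw [hBapp, hBapp, dotProduct_comm, Matrix.dotProduct_mulVec,
      ← Matrix.mulVec_transpose, A.2.eq]⟩
  have hcont : ∀ v w, Continuous fun A => B A v w := fun v w => by
    simp only [hBapp]
    exact continuous_const.dotProduct (continuous_subtype_val.matrix_mulVec continuous_const)
  rw [isOpen_iff_mem_nhds]
  intro A hA
  obtain ⟨v, hv⟩ := SplitsHyperbolicPlanes.exists_gram hk.two_ne_zero (hB A) hA
  let σ : Fin m × Fin 2 ≃ Fin (m * 2) := finProdFinEquiv
  -- The vectors stay fixed; only the form varies, along `𝓝 A`.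
  have hev := hk.eventually_exists_gram_eq_diagonal (l := 𝓝 A) B hB (m * 2)
    (fun _ i => v (σ.symm i)) (fun i => hyperbolicWeight k (σ.symm i))
    (fun i => left_ne_zero_of_mul_eq_one (hyperbolicWeight_mul_self _))
    (fun i j => by
      have := (hcont (v (σ.symm i)) (v (σ.symm j))).tendsto A
      rw [hv] at this
      simpa [Matrix.diagonal_apply] using this)
  filter_upwards [hev] with A' ⟨w, _, hw⟩
  exact splitsHyperbolicPlanes_of_gram (hB A') (fun i => w (σ i)) fun i j => by
    rw [hw]; simp [Matrix.diagonal_apply]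

theorem mainTheorem12 (k : Type*) [Field k] [TopologicalSpace k]
    (hk : IsPadicField k ∨ IsRealField k) :
    (∀ n : ℕ, 1 ≤ n → IsOpen {A : SymMatrix (2 * n) k | IsPurelyHyperbolic A.form}) ∧
    (∀ n m : ℕ, 1 ≤ n → IsOpen {A : SymMatrix n k | SplitsHyperbolicPlanes A.form m}) := by
  have h : IsLocallySquareField k :=
    hk.elim IsPadicField.isLocallySquareField IsRealField.isLocallySquareField
  exact ⟨fun n _ => h.isOpen_splitsHyperbolicPlanes (2 * n) n,
    fun n m _ => h.isOpen_splitsHyperbolicPlanes n m⟩
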